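/- There are universal constants $C_1, C_2>0$ such that the following holds. Let $d,n\ge 1$ and $K\ge 2$ be integers and let $1\le p\le\infty$. Let $\mathbf{T}=\{z\in\mathbf{C}:|z|=1\}$ and $\Omega_K=\{e^{2\pi \mathbf{i}k/K}:k=0,1,\dots,K-1\}$, and let $L^p(\mathbf{T}^n)$ and $L^p(\Omega_K^n)$ be taken with respect to the uniform probability measures on $\mathbf{T}^n$ and $\Omega_K^n$. Then for every analytic polynomial $$f(z)=\sum_{\alpha\in\{0,1,\dots,K-1\}^n,\ |\alpha|\le d}\widehat f(\alpha)\,z^{\alpha},\qquad \widehat f(\alpha)\in\mathbf{C},\quad |\alpha|=\alpha_1+\cdots+\alpha_n,\quad z^\alpha=z_1^{\alpha_1}\cdots z_n^{\alpha_n},$$ (that is, of total degree at most $d$ and of degree at most $K-1$ in each variable) one has $$\|f\|_{L^p(\mathbf{T}^n)}\le d\,(C_1\log K+C_2)^d\,\|f\|_{L^p(\Omega_K^n)}.$$ In particular the constant depends neither on $n$ nor on $p$. -/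

import Mathlib

open MeasureTheory
open scoped ENNReal

/-- The Borel σ-algebra on the unit circle `𝐓 = {z ∈ ℂ : |z| = 1}`. -/
noncomputable instance instMeasurableSpaceUnitCircle : MeasurableSpace Circle := borel Circle

instance instBorelSpaceUnitCircle : BorelSpace Circle := ⟨rfl⟩

/-- The uniform probability measure on the polytorus `𝐓ⁿ`: the `n`-fold product of the Haar
measure of the circle normalised to have total mass one. -/
noncomputable def torusMeasure (n : ℕ) : Measure (Fin n → Circle) :=
  Measure.pi fun _ => Measure.haarMeasure ⊤

/-- `Ω_K = {e^{2π i k / K} : k = 0, 1, …, K - 1}`, as a subset of the circle. -/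
def rootsOmega (K : ℕ) : Set Circle :=
  {z | ∃ k : ℕ, k < K ∧ z = Circle.exp (2 * Real.pi * k / K)}

/-- `Ω_K^n`, as a subset of `𝐓ⁿ`. -/
def cyclicGrid (K n : ℕ) : Set (Fin n → Circle) :=
  {z | ∀ j, z j ∈ rootsOmega K}

/-- The uniform probability measure on the finite set `Ω_K^n`, as a measure on `𝐓ⁿ`. -/
noncomputable def cyclicMeasure (K n : ℕ) : Measure (Fin n → Circle) :=
  ProbabilityTheory.uniformOn (cyclicGrid K n)

/-- The function `𝐓ⁿ → ℂ` given by an analytic polynomial. -/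
noncomputable def polyOnTorus {n : ℕ} (f : MvPolynomial (Fin n) ℂ) (z : Fin n → Circle) : ℂ :=
  MvPolynomial.eval (fun j => (z j : ℂ)) f

/-! For `k < K` the Dirichlet kernel recovers `z ^ k` from the values on `Ω_K`, at an `ℓ¹` cost of
at most `L = 3 + log K`. Tensoring this identity would cost `L ^ n`. It is replaced by probability
kernels, whose tensor powers are contractions `L^p(Ω_K ^ n) → L^p(𝐓 ^ n)` for every `n` and `p`
(`eLpNorm_gridConvolution_le`).

The kernel with mixing parameter `ρ ∈ [0, 1]` and phase `ζ` sends `1` to `1`, so variables absent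
from a monomial cost nothing. It sends `z ^ k`, `0 < k < K`, to `ρ (a + ζ z ^ k / (4L) + ζ⁻¹ c)`
(`exists_sum_mixedKernel_mul_pow`). A monomial involves `s ≤ d` variables, so its image is `ρ ^ s`
times a Laurent polynomial in `ζ` whose `ζ ^ s` coefficient is `z ^ α / (4L) ^ s`. Putting `ζ =
η⁻¹`, extrapolating `ρ` from the nodes `i / d` to `4Lη`, and averaging over roots of unity `η`
leaves exactly `z ^ α`, with the same weights for all `α`. These weights have total size at most
`(2e(4L + 1)) ^ d`. -/

/-! ### Dirichlet kernel on cosets of `Ω_K` -/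

/-- The mean `(1 + u + ⋯ + u^(K-1)) / K`, a normalised analytic Dirichlet kernel. -/
noncomputable def dirichletMean (K : ℕ) (u : Circle) : ℂ :=
  (K : ℂ)⁻¹ * ∑ k ∈ Finset.range K, (u : ℂ) ^ k

theorem ZMod.coe_toCircle_pow {N : ℕ} [NeZero N] (t : ZMod N) (k : ℕ) :
    (ZMod.toCircle t : ℂ) ^ k = ZMod.stdAddChar (t * (k : ZMod N)) := by
  rw [mul_comm, ← nsmul_eq_mul, AddChar.map_nsmul_eq_pow, ZMod.stdAddChar_apply]

theorem ZMod.sum_toCircle_inv_pow_mul_pow {N : ℕ} [NeZero N] {k l : ℕ} (hk : k < N) (hl : l < N) :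
    ∑ t : ZMod N, ((ZMod.toCircle t)⁻¹ : ℂ) ^ l * (ZMod.toCircle t : ℂ) ^ k =
      if l = k then (N : ℂ) else 0 := by
  have h : ∀ t : ZMod N, ((ZMod.toCircle t)⁻¹ : ℂ) ^ l * (ZMod.toCircle t : ℂ) ^ k =
      ZMod.stdAddChar (t * ((k : ZMod N) - (l : ZMod N))) := by
    intro t
    rw [mul_sub, AddChar.map_sub_eq_div, ← ZMod.coe_toCircle_pow, ← ZMod.coe_toCircle_pow,
      inv_pow, div_eq_mul_inv, mul_comm]
  simp_rw [h]
  rw [AddChar.sum_mulShift _ (ZMod.isPrimitive_stdAddChar N), ZMod.card]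
  have : ((k : ZMod N) - (l : ZMod N) = 0) ↔ l = k := by
    rw [sub_eq_zero, ZMod.natCast_eq_natCast_iff', Nat.mod_eq_of_lt hk, Nat.mod_eq_of_lt hl, eq_comm]
  simp only [this]
  split_ifs <;> simp

theorem ZMod.sum_toCircle_pow {N : ℕ} [NeZero N] {k : ℕ} (hk : k < N) :
    ∑ t : ZMod N, (ZMod.toCircle t : ℂ) ^ k = if k = 0 then (N : ℂ) else 0 := by
  simpa [eq_comm] using ZMod.sum_toCircle_inv_pow_mul_pow hk (NeZero.pos N)

theorem sum_dirichletMean_mul_pow {K : ℕ} [NeZero K] (z : Circle) {k : ℕ} (hk : k < K) :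
    ∑ t : ZMod K, dirichletMean K (z * (ZMod.toCircle t)⁻¹) * (ZMod.toCircle t : ℂ) ^ k =
      (z : ℂ) ^ k := by
  have hK : (K : ℂ) ≠ 0 := Nat.cast_ne_zero.2 (NeZero.ne K)
  have : ∀ t : ZMod K, dirichletMean K (z * (ZMod.toCircle t)⁻¹) * (ZMod.toCircle t : ℂ) ^ k =
      (K : ℂ)⁻¹ * ∑ l ∈ Finset.range K, (z : ℂ) ^ l *
        (((ZMod.toCircle t)⁻¹ : ℂ) ^ l * (ZMod.toCircle t : ℂ) ^ k) := by
    intro t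
    rw [dirichletMean, mul_assoc, Finset.sum_mul]
    congr 1
    refine Finset.sum_congr rfl fun l _ => ?_
    push_cast
    ring
  simp_rw [this]
  rw [← Finset.mul_sum, Finset.sum_comm]
  simp_rw [← Finset.mul_sum]
  rw [Finset.sum_congr rfl fun l hl => by
    rw [ZMod.sum_toCircle_inv_pow_mul_pow hk (Finset.mem_range.1 hl)]]
  simp only [mul_ite, mul_zero, Finset.sum_ite_eq', Finset.mem_range, hk, if_true]
  field_simp

theorem continuous_dirichletMean (K : ℕ) : Continuous (dirichletMean K) := by
  unfold dirichletMean
  fun_prop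

theorem norm_dirichletMean_le_one (K : ℕ) (u : Circle) : ‖dirichletMean K u‖ ≤ 1 := by
  rw [dirichletMean, norm_mul, norm_inv, Complex.norm_natCast]
  have h : ‖∑ k ∈ Finset.range K, (u : ℂ) ^ k‖ ≤ K := by
    refine (norm_sum_le _ _).trans ?_
    simp_rw [norm_pow, Circle.norm_coe]
    simp
  rcases Nat.eq_zero_or_pos K with rfl | hK
  · simp
  · rw [inv_mul_le_iff₀ (by positivity)]
    simpa using h

theorem norm_dirichletMean_mul_le (K : ℕ) (u : Circle) :
    ‖dirichletMean K u‖ * ((K : ℝ) * ‖(u : ℂ) - 1‖) ≤ 2 := by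
  rcases Nat.eq_zero_or_pos K with rfl | hK
  · simp
  have h := geom_sum_mul (u : ℂ) K
  have h2 : ‖(u : ℂ) ^ K - 1‖ ≤ 2 := by
    refine (norm_sub_le _ _).trans ?_
    rw [norm_pow, Circle.norm_coe]
    norm_num
  rw [← h, norm_mul] at h2
  rw [dirichletMean, norm_mul, norm_inv, Complex.norm_natCast]
  have : (0 : ℝ) < K := by positivity
  field_simp
  exact h2

theorem four_mul_min_le_norm_exp_sub_one {y : ℝ} (h0 : 0 ≤ y) (h1 : y ≤ 1) :
    4 * min y (1 - y) ≤ ‖(Circle.exp (2 * Real.pi * y) : ℂ) - 1‖ := by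
  have hsin : 2 * min y (1 - y) ≤ Real.sin (Real.pi * y) := by
    have hpi := Real.pi_pos
    rcases le_total y (1 / 2) with h | h
    · have := Real.mul_le_sin (x := Real.pi * y) (by positivity) (by nlinarith)
      rw [show 2 / Real.pi * (Real.pi * y) = 2 * y by field_simp] at this
      linarith [min_le_left y (1 - y)]
    · have := Real.mul_le_sin (x := Real.pi * (1 - y))
        (mul_nonneg hpi.le (by linarith)) (by nlinarith)
      rw [show 2 / Real.pi * (Real.pi * (1 - y)) = 2 * (1 - y) by field_simp,
        show Real.pi * (1 - y) = Real.pi - Real.pi * y by ring, Real.sin_pi_sub] at this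
      linarith [min_le_right y (1 - y)]
  have hn : ‖(Circle.exp (2 * Real.pi * y) : ℂ) - 1‖ = ‖2 * Real.sin (2 * Real.pi * y / 2)‖ := by
    rw [Circle.coe_exp, mul_comm, Complex.norm_exp_I_mul_ofReal_sub_one]
  rw [hn, show 2 * Real.pi * y / 2 = Real.pi * y by ring]
  exact le_trans (by linarith) (le_abs_self _)

/-- The distance from the point to `1` is at least `4 min(j, K - 1 - j) / K`. Replacing the inverse
of the minimum by the sum of both inverses makes the bound symmetric and easy to sum. -/
theorem norm_dirichletMean_exp_le {K j : ℕ} {b : ℝ} (hb0 : 0 ≤ b) (hb1 : b ≤ 1) (hj : 0 < j)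
    (hjK : j + 1 < K) :
    ‖dirichletMean K (Circle.exp (2 * Real.pi * ((j + b) / K)))‖ ≤
      2⁻¹ * ((j : ℝ)⁻¹ + ((K - 1 - j : ℕ) : ℝ)⁻¹) := by
  have hK : (0 : ℝ) < K := by exact_mod_cast (by omega : 0 < K)
  have hjr : (0 : ℝ) < j := by exact_mod_cast hj
  have hl : (0 : ℝ) < ((K - 1 - j : ℕ) : ℝ) := by exact_mod_cast (by omega : 0 < K - 1 - j)
  have hle : (K : ℝ) = ((K - 1 - j : ℕ) : ℝ) + 1 + j := by
    exact_mod_cast (by omega : K = (K - 1 - j) + 1 + j)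
  set l : ℝ := ((K - 1 - j : ℕ) : ℝ)
  have hy1 : (j + b) / K ≤ 1 := by rw [div_le_one hK]; linarith
  have h1 := four_mul_min_le_norm_exp_sub_one (y := (j + b) / K) (by positivity) hy1
  have h2 := norm_dirichletMean_mul_le K (Circle.exp (2 * Real.pi * ((j + b) / K)))
  set N := ‖dirichletMean K (Circle.exp (2 * Real.pi * ((j + b) / K)))‖
  have hN : 0 ≤ N := norm_nonneg _
  have h3 : 4 * min (j : ℝ) l ≤ K * ‖(Circle.exp (2 * Real.pi * ((j + b) / K)) : ℂ) - 1‖ := by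
    refine le_trans ?_ (mul_le_mul_of_nonneg_left h1 hK.le)
    have : min (j : ℝ) l ≤ K * min ((j + b) / K) (1 - (j + b) / K) := by
      rw [mul_min_of_nonneg _ _ hK.le]
      refine min_le_min ?_ ?_
      · rw [mul_div_cancel₀ _ hK.ne']; linarith
      · rw [mul_sub, mul_div_cancel₀ _ hK.ne']; linarith
    linarith
  have hm : 0 < min (j : ℝ) l := lt_min hjr hl
  have h4 : N * (4 * min (j : ℝ) l) ≤ 2 := (mul_le_mul_of_nonneg_left h3 hN).trans h2
  have h5 : N ≤ 2⁻¹ * (min (j : ℝ) l)⁻¹ := by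
    rw [← mul_inv, ← one_div, le_div_iff₀ (by positivity)]
    linarith
  refine h5.trans (mul_le_mul_of_nonneg_left ?_ (by norm_num))
  rcases min_choice (j : ℝ) l with h | h <;> rw [h]
  · exact le_add_of_nonneg_right (by positivity)
  · exact le_add_of_nonneg_left (by positivity)

theorem sum_norm_dirichletMean_exp_le {K : ℕ} (hK : 2 ≤ K) {b : ℝ} (hb0 : 0 ≤ b) (hb1 : b ≤ 1) :
    ∑ j ∈ Finset.range K, ‖dirichletMean K (Circle.exp (2 * Real.pi * ((j + b) / K)))‖ ≤
      3 + Real.log K := by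
  obtain ⟨m, rfl⟩ : ∃ m, K = m + 2 := ⟨K - 2, by omega⟩
  -- The two points that may be close to `1` are split off and bounded trivially by `1` each.
  rw [Finset.sum_range_succ, Finset.sum_range_succ']
  have hmid : ∑ k ∈ Finset.range m, ‖dirichletMean (m + 2)
      (Circle.exp (2 * Real.pi * (((k + 1 : ℕ) + b) / (m + 2 : ℕ))))‖ ≤ 1 + Real.log (m + 2 : ℕ) := by
    have hh : ∑ k ∈ Finset.range m, (((k + 1 : ℕ) : ℝ))⁻¹ ≤ 1 + Real.log (m + 2 : ℕ) := by
      rcases Nat.eq_zero_or_pos m with rfl | hm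
      · simp; positivity
      have := harmonic_le_one_add_log m
      simp only [harmonic] at this
      push_cast at this ⊢
      refine this.trans ?_
      have : Real.log m ≤ Real.log (m + 2) := Real.log_le_log (by exact_mod_cast hm) (by linarith)
      linarith
    calc _ ≤ ∑ k ∈ Finset.range m, 2⁻¹ * ((((k + 1 : ℕ) : ℝ))⁻¹ +
            (((m - 1 - k) + 1 : ℕ) : ℝ)⁻¹) := by
          refine Finset.sum_le_sum fun k hk => ?_
          rw [Finset.mem_range] at hk
          rw [show m - 1 - k + 1 = m + 2 - 1 - (k + 1) by omega]
          exact norm_dirichletMean_exp_le (K := m + 2) hb0 hb1 (by omega) (by omega)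
      _ = ∑ k ∈ Finset.range m, (((k + 1 : ℕ) : ℝ))⁻¹ := by
          rw [← Finset.mul_sum, Finset.sum_add_distrib,
            Finset.sum_range_reflect (fun k => (((k + 1 : ℕ) : ℝ))⁻¹) m]
          ring
      _ ≤ _ := hh
  have := norm_dirichletMean_le_one (m + 2)
    (Circle.exp (2 * Real.pi * (((m + 1 : ℕ) + b) / (m + 2 : ℕ))))
  have := norm_dirichletMean_le_one (m + 2)
    (Circle.exp (2 * Real.pi * (((0 : ℕ) + b) / (m + 2 : ℕ))))
  linarith

theorem sum_mul_toCircle_inv_reindex {K : ℕ} [NeZero K] {M : Type*} [AddCommMonoid M]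
    (F : Circle → M) (z : Circle) (s : ZMod K) :
    ∑ t : ZMod K, F (z * ZMod.toCircle s * (ZMod.toCircle t)⁻¹) =
      ∑ t : ZMod K, F (z * ZMod.toCircle t) := by
  refine Fintype.sum_equiv (Equiv.subLeft s) _ _ fun t => ?_
  rw [Equiv.subLeft_apply, AddChar.map_sub_eq_div, div_eq_mul_inv, mul_assoc]

theorem sum_norm_dirichletMean_le {K : ℕ} [NeZero K] (hK : 2 ≤ K) (z : Circle) :
    ∑ t : ZMod K, ‖dirichletMean K (z * (ZMod.toCircle t)⁻¹)‖ ≤ 3 + Real.log K := by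
  have hK0 : (0 : ℝ) < K := by exact_mod_cast (by omega : 0 < K)
  obtain ⟨x, hx⟩ : ∃ x : ℝ, z = Circle.exp (2 * Real.pi * (x / K)) := by
    refine ⟨K * (Complex.arg z / (2 * Real.pi)), ?_⟩
    rw [mul_div_cancel_left₀ _ hK0.ne', mul_div_cancel₀ _ (by positivity), Circle.exp_arg]
  -- Modulo a `K`-th root of unity, which only permutes the coset, the angle can be taken in `[0, 2π
  -- / K)`.
  have hz : z = Circle.exp (2 * Real.pi * (Int.fract x / K)) * ZMod.toCircle (⌊x⌋ : ZMod K) := by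
    apply Circle.ext
    rw [hx, Circle.coe_mul, ZMod.toCircle_intCast, Circle.coe_exp, Circle.coe_exp, ← Complex.exp_add]
    congr 1
    nth_rewrite 1 [← Int.fract_add_floor x]
    push_cast
    ring
  rw [hz, sum_mul_toCircle_inv_reindex (fun u => ‖dirichletMean K u‖)]
  refine le_of_eq_of_le ?_ (sum_norm_dirichletMean_exp_le hK (Int.fract_nonneg x)
    (Int.fract_lt_one x).le)
  rw [Finset.sum_range fun j : ℕ =>
    ‖dirichletMean K (Circle.exp (2 * Real.pi * ((j + Int.fract x) / K)))‖]
  refine (Fintype.sum_equiv (ZMod.finEquiv K).toEquiv _ _ fun j => ?_).symm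
  congr 2
  obtain ⟨m, rfl⟩ : ∃ m, K = m + 1 := ⟨K - 1, by omega⟩
  rw [ZMod.toCircle_eq_circleExp, ← Circle.exp_add]
  congr 1
  have : ((ZMod.finEquiv (m + 1)).toEquiv j).val = (j : ℕ) := rfl
  rw [this]
  ring

/-! ### Lagrange extrapolation from the nodes `i / d` -/

theorem prod_erase_range_abs_sub (d i : ℕ) (hi : i ≤ d) :
    ∏ j ∈ (Finset.range (d + 1)).erase i, |(i : ℝ) - j| = (i.factorial : ℝ) * (d - i).factorial := by
  induction d, hi using Nat.le_induction with
  | base =>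
    rw [Finset.range_add_one, Finset.erase_insert Finset.notMem_range_self, Nat.sub_self,
      Nat.factorial_zero, Nat.cast_one, mul_one, ← Finset.prod_range_add_one_eq_factorial,
      Nat.cast_prod, ← Finset.prod_range_reflect]
    refine Finset.prod_congr rfl fun j hj => ?_
    rw [Finset.mem_range] at hj
    have : (i : ℝ) - ((i - 1 - j : ℕ) : ℝ) = ((j + 1 : ℕ) : ℝ) := by
      rw [sub_eq_iff_eq_add]
      exact_mod_cast (by omega : i = j + 1 + (i - 1 - j))
    rw [this, abs_of_nonneg (by positivity)]
  | succ d hid ih =>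
    rw [Finset.range_add_one, Finset.erase_insert_of_ne (by omega : d + 1 ≠ i),
      Finset.prod_insert (by simp), ih, Nat.succ_sub hid, Nat.factorial_succ]
    have : |(i : ℝ) - ((d + 1 : ℕ) : ℝ)| = ((d - i).succ : ℕ) := by
      rw [abs_sub_comm, abs_of_nonneg (by
        rw [sub_nonneg]; exact_mod_cast (by omega : i ≤ d + 1)), sub_eq_iff_eq_add]
      exact_mod_cast (by omega : d + 1 = (d - i).succ + i)
    rw [this]
    push_cast
    ring

theorem norm_eval_lagrange_basis_le {d : ℕ} (hd : 1 ≤ d) {i : ℕ} (hi : i ≤ d) (w : ℂ) :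
    ‖((Lagrange.basis (Finset.range (d + 1)) (fun j : ℕ => (j / d : ℂ)) i)).eval w‖ ≤
      (d * (‖w‖ + 1)) ^ d / ((i.factorial : ℝ) * (d - i).factorial) := by
  have hd0 : (0 : ℝ) < d := by exact_mod_cast hd
  have hd0' : (d : ℂ) ≠ 0 := by exact_mod_cast hd0.ne'
  rw [Lagrange.basis, Polynomial.eval_prod, norm_prod, ← prod_erase_range_abs_sub d i hi]
  have hcard : ((Finset.range (d + 1)).erase i).card = d := by
    rw [Finset.card_erase_of_mem (Finset.mem_range.2 (by omega)), Finset.card_range]; omega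
  have h2 : ((d : ℝ) * (‖w‖ + 1)) ^ d =
      ∏ _j ∈ (Finset.range (d + 1)).erase i, (d : ℝ) * (‖w‖ + 1) := by
    rw [Finset.prod_const, hcard]
  rw [h2, ← Finset.prod_div_distrib]
  refine Finset.prod_le_prod (fun _ _ => norm_nonneg _) fun j hj => ?_
  obtain ⟨hji, hj⟩ := Finset.mem_erase.1 hj
  have hj' : j ≤ d := by rw [Finset.mem_range] at hj; omega
  have hij : (0 : ℝ) < |(i : ℝ) - j| := abs_pos.2 (sub_ne_zero.2 (by exact_mod_cast hji.symm))
  have h3 : ‖((i : ℂ) / d - j / d)‖ = |(i : ℝ) - j| / d := by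
    rw [← sub_div, norm_div, Complex.norm_natCast, ← Complex.ofReal_natCast,
      ← Complex.ofReal_natCast, ← Complex.ofReal_sub, Complex.norm_real, Real.norm_eq_abs]
  have h4 : ‖w - (j : ℂ) / d‖ ≤ ‖w‖ + 1 := by
    refine (norm_sub_le _ _).trans (add_le_add_right ?_ _)
    rw [norm_div, Complex.norm_natCast, Complex.norm_natCast, div_le_one hd0]
    exact_mod_cast hj'
  simp only [Lagrange.basisDivisor, Polynomial.eval_mul, Polynomial.eval_C, Polynomial.eval_sub,
    Polynomial.eval_X, norm_mul, norm_inv]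
  rw [h3, inv_div, div_mul_eq_mul_div]
  gcongr

/-- The denominators `i! (d - i)!` turn the sum into `∑ choose d i = 2 ^ d`, and `d ^ d / d! ≤ e ^
d`. -/
theorem sum_norm_eval_lagrange_basis_le {d : ℕ} (hd : 1 ≤ d) (w : ℂ) :
    ∑ i ∈ Finset.range (d + 1),
      ‖((Lagrange.basis (Finset.range (d + 1)) (fun j : ℕ => (j / d : ℂ)) i)).eval w‖ ≤
      (2 * Real.exp 1 * (‖w‖ + 1)) ^ d := by
  have hfac : (0 : ℝ) < d.factorial := by exact_mod_cast d.factorial_pos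
  calc _ ≤ ∑ i ∈ Finset.range (d + 1),
        (d * (‖w‖ + 1)) ^ d / ((i.factorial : ℝ) * (d - i).factorial) :=
        Finset.sum_le_sum fun i hi =>
          norm_eval_lagrange_basis_le hd (by rw [Finset.mem_range] at hi; omega) w
    _ = ∑ i ∈ Finset.range (d + 1), (d * (‖w‖ + 1)) ^ d / d.factorial * (d.choose i : ℝ) := by
        refine Finset.sum_congr rfl fun i hi => ?_
        rw [Nat.cast_choose ℝ (by rw [Finset.mem_range] at hi; omega : i ≤ d)]
        field_simp
    _ = (d : ℝ) ^ d / d.factorial * (‖w‖ + 1) ^ d * 2 ^ d := by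
        rw [← Finset.mul_sum, ← Nat.cast_sum, Nat.sum_range_choose, mul_pow]
        push_cast
        ring
    _ ≤ Real.exp d * (‖w‖ + 1) ^ d * 2 ^ d := by
        gcongr
        exact Real.pow_div_factorial_le_exp d (by positivity) d
    _ = _ := by
        rw [mul_pow, mul_pow, ← Real.exp_nat_mul, mul_one]
        ring

/-- Lagrange interpolation at the nodes `i / d` is exact on monomials of degree at most `d`. -/
theorem sum_eval_lagrange_basis_mul_pow {d m : ℕ} (hd : 1 ≤ d) (hm : m ≤ d) (w : ℂ) :
    ∑ i ∈ Finset.range (d + 1),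
      ((Lagrange.basis (Finset.range (d + 1)) (fun j : ℕ => (j / d : ℂ)) i)).eval w *
        ((i : ℂ) / d) ^ m = w ^ m := by
  have hd0 : (d : ℂ) ≠ 0 := Nat.cast_ne_zero.2 (by omega)
  have hinj : Set.InjOn (fun j : ℕ => (j / d : ℂ)) (Finset.range (d + 1)) := by
    intro a _ b _ hab
    simpa [div_left_inj' hd0] using hab
  have h := Lagrange.eq_interpolate (f := (Polynomial.X : Polynomial ℂ) ^ m) hinj (by
    rw [Polynomial.degree_X_pow, Finset.card_range]; exact_mod_cast Nat.lt_succ_of_le hm)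
  have h2 := congrArg (Polynomial.eval w) h
  rw [Lagrange.interpolate_apply, Polynomial.eval_finsetSum] at h2
  simp only [Polynomial.eval_pow, Polynomial.eval_X, Polynomial.eval_mul, Polynomial.eval_C] at h2
  rw [h2]
  exact Finset.sum_congr rfl fun i _ => mul_comm _ _

/-- Averaging a polynomial of degree less than `N` over the `N`-th roots of unity gives its constant
coefficient. -/
theorem sum_eval_toCircle {N : ℕ} [NeZero N] (Q : Polynomial ℂ) (hQ : Q.natDegree < N) :
    ∑ t : ZMod N, Q.eval (ZMod.toCircle t : ℂ) = N * Q.coeff 0 := by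
  simp_rw [Polynomial.eval_eq_sum_range' hQ]
  rw [Finset.sum_comm]
  simp_rw [← Finset.mul_sum]
  rw [Finset.sum_congr rfl fun l hl => by rw [ZMod.sum_toCircle_pow (Finset.mem_range.1 hl)]]
  simp [NeZero.pos N, mul_comm]

/-! ### Uniform measures on the grid and the torus -/

theorem rootsOmega_eq_range_toCircle (K : ℕ) [NeZero K] :
    rootsOmega K = Set.range (ZMod.toCircle : ZMod K → Circle) := by
  ext z
  constructor
  · rintro ⟨k, hk, rfl⟩
    refine ⟨(k : ZMod K), ?_⟩
    rw [ZMod.toCircle_eq_circleExp, ZMod.val_natCast, Nat.mod_eq_of_lt hk, mul_div_assoc]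
  · rintro ⟨t, rfl⟩
    exact ⟨t.val, t.val_lt, by rw [ZMod.toCircle_eq_circleExp, mul_div_assoc]⟩

/-- The point of `Ω_K ^ n` with the given exponents. -/
noncomputable def gridPoint {K n : ℕ} [NeZero K] (w : Fin n → ZMod K) : Fin n → Circle :=
  fun j => ZMod.toCircle (w j)

theorem gridPoint_injective {K n : ℕ} [NeZero K] :
    Function.Injective (gridPoint : (Fin n → ZMod K) → Fin n → Circle) := fun _ _ h =>
  funext fun j => ZMod.injective_toCircle (congrFun h j)

theorem cyclicGrid_eq_range_gridPoint (K n : ℕ) [NeZero K] :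
    cyclicGrid K n = Set.range (gridPoint : (Fin n → ZMod K) → Fin n → Circle) := by
  ext z
  simp only [cyclicGrid, rootsOmega_eq_range_toCircle, Set.mem_ofPred_eq, Set.mem_range]
  constructor
  · intro h
    choose w hw using h
    exact ⟨w, funext hw⟩
  · rintro ⟨w, rfl⟩ j
    exact ⟨w j, rfl⟩

theorem lintegral_cyclicMeasure (K n : ℕ) [NeZero K] (g : (Fin n → Circle) → ℝ≥0∞) :
    ∫⁻ z, g z ∂cyclicMeasure K n = ((K : ℝ≥0∞) ^ n)⁻¹ * ∑ w : Fin n → ZMod K, g (gridPoint w) := by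
  classical
  have hS : cyclicGrid K n = ((Finset.univ.map ⟨_, gridPoint_injective (K := K) (n := n)⟩ :
      Finset (Fin n → Circle)) : Set (Fin n → Circle)) := by
    rw [cyclicGrid_eq_range_gridPoint]; simp
  rw [cyclicMeasure, hS, ProbabilityTheory.uniformOn, ProbabilityTheory.cond,
    lintegral_smul_measure, lintegral_finset, Measure.count_apply_finset, Finset.sum_map,
    Finset.card_map, Finset.card_univ, Fintype.card_fun, ZMod.card, Fintype.card_fin]
  simp

/-- Each grid point has positive mass, so the almost everywhere bound holds there. -/
theorem enorm_le_eLpNorm_top_cyclicMeasure {K n : ℕ} [NeZero K] (F : (Fin n → Circle) → ℂ)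
    (w : Fin n → ZMod K) : ‖F (gridPoint w)‖ₑ ≤ eLpNorm F ∞ (cyclicMeasure K n) := by
  rw [eLpNorm_exponent_top]
  have h : ∀ᵐ z ∂cyclicMeasure K n, ‖F z‖ₑ ≤ eLpNormEssSup F (cyclicMeasure K n) :=
    ae_le_eLpNormEssSup
  by_contra hw
  have h0 : cyclicMeasure K n {gridPoint w} = 0 :=
    measure_mono_null (Set.singleton_subset_iff.2 hw) (ae_iff.1 h)
  rw [← lintegral_indicator_one (measurableSet_singleton _), lintegral_cyclicMeasure, mul_eq_zero,
    Finset.sum_eq_zero_iff] at h0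
  rcases h0 with h0 | h0
  · exact ENNReal.inv_ne_zero.2 (ENNReal.pow_ne_top (ENNReal.natCast_ne_top K)) h0
  · simpa using h0 w (Finset.mem_univ _)

instance isMulLeftInvariant_torusMeasure (n : ℕ) : (torusMeasure n).IsMulLeftInvariant := by
  unfold torusMeasure
  infer_instance

instance isProbabilityMeasure_haarMeasure_top_circle :
    IsProbabilityMeasure (Measure.haarMeasure (⊤ : TopologicalSpace.PositiveCompacts Circle)) :=
  ⟨by simpa using Measure.haarMeasure_self (K₀ := (⊤ : TopologicalSpace.PositiveCompacts Circle))⟩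

instance isProbabilityMeasure_torusMeasure (n : ℕ) : IsProbabilityMeasure (torusMeasure n) := by
  unfold torusMeasure
  infer_instance

/-! ### Contraction by probability kernels -/

/-- Convolution over `Ω_K ^ n` of the function `F` with the tensor power of the kernel `M`. -/
noncomputable def gridConvolution (K : ℕ) [NeZero K] {n : ℕ} (M : Circle → ℝ)
    (F : (Fin n → Circle) → ℂ) (z : Fin n → Circle) : ℂ :=
  ∑ w : Fin n → ZMod K, ((∏ j, M (z j * (ZMod.toCircle (w j))⁻¹) : ℝ) : ℂ) * F (gridPoint w)

theorem continuous_gridConvolution {K n : ℕ} [NeZero K] {M : Circle → ℝ} (hM : Continuous M)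
    (F : (Fin n → Circle) → ℂ) : Continuous (gridConvolution K M F) := by
  unfold gridConvolution
  fun_prop

section Contraction

variable {K n : ℕ} [NeZero K] {M : Circle → ℝ}

theorem sum_prod_ofReal_kernel (hM0 : ∀ u, 0 ≤ M u)
    (hM1 : ∀ z, ∑ t : ZMod K, M (z * (ZMod.toCircle t)⁻¹) = 1) (z : Fin n → Circle) :
    ∑ w : Fin n → ZMod K, ENNReal.ofReal (∏ j, M (z j * (ZMod.toCircle (w j))⁻¹)) = 1 := by
  rw [← ENNReal.ofReal_sum_of_nonneg fun w _ => Finset.prod_nonneg fun j _ => hM0 _]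
  have := Finset.prod_univ_sum (fun _ : Fin n => (Finset.univ : Finset (ZMod K)))
    (fun j t => M (z j * (ZMod.toCircle t)⁻¹))
  rw [Fintype.piFinset_univ] at this
  rw [← this]
  simp [hM1]

/-- By Haar invariance the `K ^ n` translates have equal integrals, and these add up to `1`. -/
theorem lintegral_prod_ofReal_kernel (hMc : Continuous M) (hM0 : ∀ u, 0 ≤ M u)
    (hM1 : ∀ z, ∑ t : ZMod K, M (z * (ZMod.toCircle t)⁻¹) = 1) (w : Fin n → ZMod K) :
    ∫⁻ z, ENNReal.ofReal (∏ j, M (z j * (ZMod.toCircle (w j))⁻¹)) ∂torusMeasure n =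
      ((K : ℝ≥0∞) ^ n)⁻¹ := by
  have hinv : ∀ w : Fin n → ZMod K,
      ∫⁻ z, ENNReal.ofReal (∏ j, M (z j * (ZMod.toCircle (w j))⁻¹)) ∂torusMeasure n =
      ∫⁻ z, ENNReal.ofReal (∏ j, M (z j)) ∂torusMeasure n := fun w => by
    rw [← lintegral_mul_left_eq_self (fun z => ENNReal.ofReal (∏ j, M (z j))) (gridPoint w)⁻¹]
    simp only [Pi.mul_apply, Pi.inv_apply, gridPoint, mul_comm]
  have hsum : ∑ w : Fin n → ZMod K,
      ∫⁻ z, ENNReal.ofReal (∏ j, M (z j * (ZMod.toCircle (w j))⁻¹)) ∂torusMeasure n = 1 := by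
    rw [← lintegral_finsetSum _ fun w _ => by
      exact (ENNReal.continuous_ofReal.comp (by fun_prop)).measurable]
    simp_rw [sum_prod_ofReal_kernel hM0 hM1]
    simp
  simp_rw [hinv] at hsum ⊢
  rw [Finset.sum_const, Finset.card_univ, Fintype.card_fun, ZMod.card, Fintype.card_fin,
    nsmul_eq_mul, Nat.cast_pow, mul_comm] at hsum
  exact ENNReal.eq_inv_of_mul_eq_one_left hsum

theorem enorm_gridConvolution_le (hM0 : ∀ u, 0 ≤ M u) (F : (Fin n → Circle) → ℂ)
    (z : Fin n → Circle) :
    ‖gridConvolution K M F z‖ₑ ≤ ∑ w : Fin n → ZMod K,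
      ENNReal.ofReal (∏ j, M (z j * (ZMod.toCircle (w j))⁻¹)) * ‖F (gridPoint w)‖ₑ := by
  refine (enorm_sum_le _ _).trans (Finset.sum_le_sum fun w _ => ?_)
  rw [enorm_mul, ← ofReal_norm, Complex.norm_real, Real.norm_of_nonneg
    (Finset.prod_nonneg fun j _ => hM0 _)]

/-- Convolution with a probability kernel on `Ω_K ^ n` is a contraction
`L^p(Ω_K ^ n) → L^p(𝐓 ^ n)`. -/
theorem eLpNorm_gridConvolution_le (hMc : Continuous M) (hM0 : ∀ u, 0 ≤ M u)
    (hM1 : ∀ z, ∑ t : ZMod K, M (z * (ZMod.toCircle t)⁻¹) = 1) {p : ℝ≥0∞} (hp : 1 ≤ p)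
    (F : (Fin n → Circle) → ℂ) :
    eLpNorm (gridConvolution K M F) p (torusMeasure n) ≤ eLpNorm F p (cyclicMeasure K n) := by
  rcases eq_or_ne p ∞ with rfl | hptop
  · rw [eLpNorm_exponent_top]
    refine eLpNormEssSup_le_of_ae_enorm_bound (.of_forall fun z => ?_)
    calc _ ≤ _ := enorm_gridConvolution_le hM0 F z
      _ ≤ ∑ w : Fin n → ZMod K, ENNReal.ofReal (∏ j, M (z j * (ZMod.toCircle (w j))⁻¹)) *
            eLpNorm F ∞ (cyclicMeasure K n) :=
          Finset.sum_le_sum fun w _ => by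
            gcongr
            exact enorm_le_eLpNorm_top_cyclicMeasure F w
      _ = _ := by rw [← Finset.sum_mul, sum_prod_ofReal_kernel hM0 hM1, one_mul]
  have hp0 : p ≠ 0 := (zero_lt_one.trans_le hp).ne'
  have hp1 : 1 ≤ p.toReal := by
    simpa using ENNReal.toReal_mono hptop hp
  rw [eLpNorm_eq_lintegral_rpow_enorm_toReal hp0 hptop,
    eLpNorm_eq_lintegral_rpow_enorm_toReal hp0 hptop]
  refine ENNReal.rpow_le_rpow ?_ (by positivity)
  calc ∫⁻ z, ‖gridConvolution K M F z‖ₑ ^ p.toReal ∂torusMeasure n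
      ≤ ∫⁻ z, ∑ w : Fin n → ZMod K, ENNReal.ofReal (∏ j, M (z j * (ZMod.toCircle (w j))⁻¹)) *
          ‖F (gridPoint w)‖ₑ ^ p.toReal ∂torusMeasure n := by
        refine lintegral_mono fun z => ?_
        -- Jensen's inequality: at each `z` the weights sum to `1`.
        exact (ENNReal.rpow_le_rpow (enorm_gridConvolution_le hM0 F z) (by positivity)).trans
          (ENNReal.rpow_arith_mean_le_arith_mean_rpow _ _ _ (sum_prod_ofReal_kernel hM0 hM1 z) hp1)
    _ = ∑ w : Fin n → ZMod K, ((K : ℝ≥0∞) ^ n)⁻¹ * ‖F (gridPoint w)‖ₑ ^ p.toReal := by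
        have hmeas : ∀ w : Fin n → ZMod K, Measurable fun z : Fin n → Circle =>
            ENNReal.ofReal (∏ j, M (z j * (ZMod.toCircle (w j))⁻¹)) := fun w =>
          (ENNReal.continuous_ofReal.comp (by fun_prop)).measurable
        rw [lintegral_finsetSum _ fun w _ => (hmeas w).mul_const _]
        refine Finset.sum_congr rfl fun w _ => ?_
        rw [lintegral_mul_const _ (hmeas w), lintegral_prod_ofReal_kernel hMc hM0 hM1]
    _ = _ := by rw [← Finset.mul_sum, lintegral_cyclicMeasure]

end Contraction

/-! ### The mixed kernel -/

/-- A nonnegative function on the circle encoding a rotation of the Dirichlet kernel. -/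
noncomputable def dirichletBump (K : ℕ) (ζ u : Circle) : ℝ :=
  ‖dirichletMean K u‖ + ((ζ : ℂ) * dirichletMean K u).re

/-- The kernel which, on each coset of `Ω_K`, mixes the uniform distribution with a `ρ`-multiple of
the normalised `dirichletBump`. -/
noncomputable def mixedKernel (K : ℕ) [NeZero K] (L ρ : ℝ) (ζ u : Circle) : ℝ :=
  (1 - ρ * ((∑ t : ZMod K, dirichletBump K ζ (u * (ZMod.toCircle t)⁻¹)) / (2 * L))) / K +
    ρ * (dirichletBump K ζ u / (2 * L))

section Kernel

variable {K : ℕ} {L ρ : ℝ}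

theorem continuous_dirichletBump (K : ℕ) (ζ : Circle) : Continuous (dirichletBump K ζ) := by
  have := continuous_dirichletMean K
  unfold dirichletBump
  fun_prop

theorem abs_re_mul_dirichletMean_le (ζ u : Circle) :
    |((ζ : ℂ) * dirichletMean K u).re| ≤ ‖dirichletMean K u‖ := by
  refine (Complex.abs_re_le_norm _).trans ?_
  rw [norm_mul, Circle.norm_coe, one_mul]

theorem dirichletBump_nonneg (ζ u : Circle) : 0 ≤ dirichletBump K ζ u := by
  have := neg_le_of_abs_le (abs_re_mul_dirichletMean_le (K := K) ζ u)
  unfold dirichletBump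
  linarith

theorem dirichletBump_le (ζ u : Circle) : dirichletBump K ζ u ≤ 2 * ‖dirichletMean K u‖ := by
  have := le_of_abs_le (abs_re_mul_dirichletMean_le (K := K) ζ u)
  unfold dirichletBump
  linarith

variable [NeZero K]

theorem continuous_mixedKernel (ζ : Circle) : Continuous (mixedKernel K L ρ ζ) := by
  have := continuous_dirichletBump K ζ
  unfold mixedKernel
  fun_prop

theorem sum_dirichletBump_le
    (hL : ∀ z, ∑ t : ZMod K, ‖dirichletMean K (z * (ZMod.toCircle t)⁻¹)‖ ≤ L) (ζ z : Circle) :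
    ∑ t : ZMod K, dirichletBump K ζ (z * (ZMod.toCircle t)⁻¹) ≤ 2 * L := by
  refine (Finset.sum_le_sum fun t _ => dirichletBump_le ζ _).trans ?_
  rw [← Finset.mul_sum]
  linarith [hL z]

/-- The normalised bump has coset mass in `[0, 1]`, so for `ρ ≤ 1` the uniform part keeps a
nonnegative coefficient. -/
theorem mixedKernel_nonneg (hL0 : 0 < L)
    (hL : ∀ z, ∑ t : ZMod K, ‖dirichletMean K (z * (ZMod.toCircle t)⁻¹)‖ ≤ L)
    (hρ0 : 0 ≤ ρ) (hρ1 : ρ ≤ 1) (ζ u : Circle) : 0 ≤ mixedKernel K L ρ ζ u := by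
  have h1 := (div_le_one (by positivity : 0 < 2 * L)).2 (sum_dirichletBump_le hL ζ u)
  have h2 := mul_le_one₀ hρ1 (div_nonneg (Finset.sum_nonneg fun t _ =>
    dirichletBump_nonneg (K := K) ζ (u * (ZMod.toCircle t)⁻¹)) (by positivity : 0 ≤ 2 * L)) h1
  have h3 := dirichletBump_nonneg (K := K) ζ u
  have h4 : (0 : ℝ) ≤ K := Nat.cast_nonneg K
  exact add_nonneg (div_nonneg (by linarith) h4) (by positivity)

theorem sum_dirichletBump_mul_toCircle_inv (ζ z : Circle) (s : ZMod K) :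
    ∑ t : ZMod K, dirichletBump K ζ (z * (ZMod.toCircle s)⁻¹ * (ZMod.toCircle t)⁻¹) =
      ∑ t : ZMod K, dirichletBump K ζ (z * (ZMod.toCircle t)⁻¹) := by
  refine Fintype.sum_equiv (Equiv.addLeft s) _ _ fun t => ?_
  rw [Equiv.coe_addLeft, AddChar.map_add_eq_mul, mul_inv, mul_assoc]

theorem mixedKernel_mul_toCircle_inv (ζ z : Circle) (s : ZMod K) :
    mixedKernel K L ρ ζ (z * (ZMod.toCircle s)⁻¹) =
      (1 - ρ * ((∑ t : ZMod K, dirichletBump K ζ (z * (ZMod.toCircle t)⁻¹)) / (2 * L))) / K +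
        ρ * (dirichletBump K ζ (z * (ZMod.toCircle s)⁻¹) / (2 * L)) := by
  rw [mixedKernel, sum_dirichletBump_mul_toCircle_inv]

theorem sum_mixedKernel (ζ z : Circle) :
    ∑ t : ZMod K, mixedKernel K L ρ ζ (z * (ZMod.toCircle t)⁻¹) = 1 := by
  simp_rw [mixedKernel_mul_toCircle_inv]
  have hK : (K : ℝ) ≠ 0 := Nat.cast_ne_zero.2 (NeZero.ne K)
  rw [Finset.sum_add_distrib, Finset.sum_const, Finset.card_univ, ZMod.card, nsmul_eq_mul,
    mul_div_cancel₀ _ hK, ← Finset.mul_sum, ← Finset.sum_div]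
  ring

/-- The uniform part vanishes because `k ≠ 0`. Writing `Re (ζD) = (ζD + ζ⁻¹ conj D) / 2`, the
reproducing property of `D` gives the coefficient of `ζ`, while `|D|` and `conj D` give `a` and `c`.
What matters is that these depend on neither `ρ` nor `ζ`. -/
theorem exists_sum_mixedKernel_mul_pow (z : Circle) {k : ℕ} (hk0 : k ≠ 0) (hk : k < K) :
    ∃ a c : ℂ, ∀ (ρ : ℝ) (ζ : Circle),
      ∑ t : ZMod K, (mixedKernel K L ρ ζ (z * (ZMod.toCircle t)⁻¹) : ℂ) *
        (ZMod.toCircle t : ℂ) ^ k =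
      ρ * (a + (ζ : ℂ) * ((z : ℂ) ^ k / (4 * L)) + (ζ : ℂ)⁻¹ * c) := by
  refine ⟨(∑ t : ZMod K, (‖dirichletMean K (z * (ZMod.toCircle t)⁻¹)‖ : ℂ) *
      (ZMod.toCircle t : ℂ) ^ k) / (2 * L),
    (∑ t : ZMod K, (starRingEnd ℂ (dirichletMean K (z * (ZMod.toCircle t)⁻¹))) *
      (ZMod.toCircle t : ℂ) ^ k) / (4 * L), fun ρ ζ => ?_⟩
  have hb : ∀ u : Circle, (dirichletBump K ζ u : ℂ) = ‖dirichletMean K u‖ +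
      ((ζ : ℂ) * dirichletMean K u + (ζ : ℂ)⁻¹ * starRingEnd ℂ (dirichletMean K u)) / 2 := by
    intro u
    rw [dirichletBump, Complex.ofReal_add, Complex.re_eq_add_conj, map_mul, ← Circle.coe_inv_eq_conj,
      Circle.coe_inv]
  rw [← sum_dirichletMean_mul_pow z hk]
  simp_rw [mixedKernel_mul_toCircle_inv, Complex.ofReal_add, add_mul]
  rw [Finset.sum_add_distrib, ← Finset.mul_sum, ZMod.sum_toCircle_pow hk, if_neg hk0, mul_zero,
    zero_add]
  simp_rw [Complex.ofReal_mul, Complex.ofReal_div, hb, Finset.sum_div, Finset.mul_sum,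
    ← Finset.sum_add_distrib, Finset.mul_sum]
  refine Finset.sum_congr rfl fun t _ => ?_
  push_cast
  ring

end Kernel

/-! ### Extrapolation in the mixing parameter -/

theorem gridConvolution_polyOnTorus {K n : ℕ} [NeZero K] (M : Circle → ℝ)
    (f : MvPolynomial (Fin n) ℂ) (z : Fin n → Circle) :
    gridConvolution K M (polyOnTorus f) z = ∑ α ∈ f.support, f.coeff α *
      ∏ j, ∑ t : ZMod K, (M (z j * (ZMod.toCircle t)⁻¹) : ℂ) * (ZMod.toCircle t : ℂ) ^ α j := by
  simp_rw [gridConvolution, polyOnTorus, MvPolynomial.eval_eq', Finset.mul_sum]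
  rw [Finset.sum_comm]
  refine Finset.sum_congr rfl fun α _ => ?_
  rw [Finset.prod_univ_sum, Fintype.piFinset_univ, Finset.mul_sum]
  refine Finset.sum_congr rfl fun w _ => ?_
  rw [Finset.prod_mul_distrib, Complex.ofReal_prod]
  simp only [gridPoint]
  ring

/-- The weight at the `i`-th node and the root of unity `t` which extrapolates a polynomial
of degree at most `d` in the mixing parameter to the point with modulus `A`. -/
noncomputable def extrapolationWeight (d N : ℕ) [NeZero N] (A : ℝ) (i : ℕ) (t : ZMod N) : ℂ :=
  (N : ℂ)⁻¹ * (Lagrange.basis (Finset.range (d + 1)) (fun j : ℕ => (j / d : ℂ)) i).eval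
    (A * (ZMod.toCircle t : ℂ))

theorem sum_norm_extrapolationWeight_le {d N : ℕ} [NeZero N] (hd : 1 ≤ d) {A : ℝ} (hA : 0 ≤ A) :
    ∑ t : ZMod N, ∑ i ∈ Finset.range (d + 1), ‖extrapolationWeight d N A i t‖ ≤
      (2 * Real.exp 1 * (A + 1)) ^ d := by
  have hN : (N : ℝ) ≠ 0 := Nat.cast_ne_zero.2 (NeZero.ne N)
  simp_rw [extrapolationWeight, norm_mul, norm_inv, Complex.norm_natCast, ← Finset.mul_sum]
  rw [inv_mul_le_iff₀ (by positivity)]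
  calc _ ≤ ∑ _t : ZMod N, (2 * Real.exp 1 * (A + 1)) ^ d := by
        refine Finset.sum_le_sum fun t _ => ?_
        have := sum_norm_eval_lagrange_basis_le hd (A * (ZMod.toCircle t : ℂ))
        rwa [norm_mul, Circle.norm_coe, mul_one, Complex.norm_real, Real.norm_of_nonneg hA] at this
    _ = _ := by rw [Finset.sum_const, Finset.card_univ, ZMod.card, nsmul_eq_mul]

theorem sum_extrapolationWeight_mul_prod {d N : ℕ} [NeZero N] (hd : 1 ≤ d) (hN : 2 * d < N) (A : ℝ)
    {ι : Type*} (S : Finset ι) (hS : S.card ≤ d) (a b c : ι → ℂ) :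
    ∑ t : ZMod N, ∑ i ∈ Finset.range (d + 1), extrapolationWeight d N A i t *
      ∏ j ∈ S, ((((i : ℝ) / d : ℝ) : ℂ) * (a j + ((ZMod.toCircle t)⁻¹ : Circle) * b j +
        (((ZMod.toCircle t)⁻¹ : Circle) : ℂ)⁻¹ * c j)) = ∏ j ∈ S, (A * b j) := by
  -- With `η` the root of unity, the factor `η ^ |S|` coming from extrapolation to `Aη` clears the
  -- poles. The result has degree at most `2d < N`, so averaging isolates the constant term `∏ b j`.
  set Q : Polynomial ℂ := ∏ j ∈ S, (Polynomial.C (c j) * Polynomial.X ^ 2 +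
    Polynomial.C (a j) * Polynomial.X + Polynomial.C (b j)) with hQ
  have hdeg : Q.natDegree < N := by
    refine lt_of_le_of_lt (Polynomial.natDegree_prod_le _ _) ?_
    refine lt_of_le_of_lt (Finset.sum_le_card_nsmul _ _ 2 fun j _ =>
      Polynomial.natDegree_quadratic_le) ?_
    rw [smul_eq_mul]
    omega
  have hN0 : (N : ℂ) ≠ 0 := Nat.cast_ne_zero.2 (NeZero.ne N)
  have hterm : ∀ t : ZMod N, ∑ i ∈ Finset.range (d + 1), extrapolationWeight d N A i t *
      ∏ j ∈ S, ((((i : ℝ) / d : ℝ) : ℂ) * (a j + ((ZMod.toCircle t)⁻¹ : Circle) * b j +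
        (((ZMod.toCircle t)⁻¹ : Circle) : ℂ)⁻¹ * c j)) =
      (N : ℂ)⁻¹ * (A : ℂ) ^ S.card * Q.eval (ZMod.toCircle t : ℂ) := by
    intro t
    set η : ℂ := (ZMod.toCircle t : ℂ)
    have hη : η ≠ 0 := Circle.coe_ne_zero _
    have hprod : Q.eval η =
        η ^ S.card * ∏ j ∈ S, (a j + η⁻¹ * b j + η * c j) := by
      rw [hQ, Polynomial.eval_prod, ← Finset.prod_const, ← Finset.prod_mul_distrib]
      refine Finset.prod_congr rfl fun j _ => ?_
      simp only [Polynomial.eval_add, Polynomial.eval_mul, Polynomial.eval_C, Polynomial.eval_pow,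
        Polynomial.eval_X]
      field_simp
      ring
    rw [hprod, show (N : ℂ)⁻¹ * (A : ℂ) ^ S.card *
      (η ^ S.card * ∏ j ∈ S, (a j + η⁻¹ * b j + η * c j)) =
      (A * η) ^ S.card * ((N : ℂ)⁻¹ * ∏ j ∈ S, (a j + η⁻¹ * b j + η * c j)) by ring,
      ← sum_eval_lagrange_basis_mul_pow hd hS, Finset.sum_mul]
    refine Finset.sum_congr rfl fun i _ => ?_
    rw [Finset.prod_mul_distrib, Finset.prod_const, extrapolationWeight, Circle.coe_inv, inv_inv]
    push_cast
    ring
  simp_rw [hterm]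
  rw [← Finset.mul_sum, sum_eval_toCircle Q hdeg, Polynomial.coeff_zero_eq_eval_zero, hQ,
    Polynomial.eval_prod, Finset.prod_mul_distrib, Finset.prod_const]
  simp only [Polynomial.eval_add, Polynomial.eval_mul, Polynomial.eval_C, Polynomial.eval_pow,
    Polynomial.eval_X]
  field_simp
  simp

/-- A polynomial of degree at most `d`, and of degree less than `K` in each variable, is a linear
combination of convolutions of its restriction to `Ω_K ^ n` with probability kernels. -/
theorem polyOnTorus_eq_sum_gridConvolution {d n K N : ℕ} [NeZero K] [NeZero N] (hd : 1 ≤ d)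
    (hN : 2 * d < N) {L : ℝ} (hL0 : 0 < L) (f : MvPolynomial (Fin n) ℂ) (hf : f.totalDegree ≤ d)
    (hfK : ∀ j, f.degreeOf j < K) :
    polyOnTorus f = ∑ t : ZMod N, ∑ i ∈ Finset.range (d + 1),
      extrapolationWeight d N (4 * L) i t •
        gridConvolution K (mixedKernel K L ((i : ℝ) / d) (ZMod.toCircle t)⁻¹) (polyOnTorus f) := by
  funext z
  simp only [Finset.sum_apply, Pi.smul_apply, smul_eq_mul, gridConvolution_polyOnTorus,
    Finset.mul_sum]
  rw [Finset.sum_congr rfl fun t _ => Finset.sum_comm, Finset.sum_comm, polyOnTorus,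
    MvPolynomial.eval_eq']
  refine Finset.sum_congr rfl fun α hα => ?_
  simp_rw [mul_left_comm _ (f.coeff α), ← Finset.mul_sum]
  congr 1
  have hcard : α.support.card ≤ d := by
    refine le_trans ?_ ((MvPolynomial.le_totalDegree hα).trans hf)
    rw [Finset.card_eq_sum_ones]
    exact Finset.sum_le_sum fun j hj => Nat.one_le_iff_ne_zero.2 (Finsupp.mem_support_iff.1 hj)
  have hαK : ∀ j, α j < K := fun j => (MvPolynomial.monomial_le_degreeOf j hα).trans_lt (hfK j)
  have hmom : ∀ j, ∃ a c : ℂ, j ∈ α.support → ∀ (ρ : ℝ) (ζ : Circle),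
      ∑ t : ZMod K, (mixedKernel K L ρ ζ (z j * (ZMod.toCircle t)⁻¹) : ℂ) *
        (ZMod.toCircle t : ℂ) ^ α j =
      ρ * (a + (ζ : ℂ) * ((z j : ℂ) ^ α j / (4 * L)) + (ζ : ℂ)⁻¹ * c) := by
    intro j
    by_cases hj : j ∈ α.support
    · obtain ⟨a, c, h⟩ := exists_sum_mixedKernel_mul_pow (L := L) (z j)
        (Finsupp.mem_support_iff.1 hj) (hαK j)
      exact ⟨a, c, fun _ => h⟩
    · exact ⟨0, 0, fun h => absurd h hj⟩
  choose a c hac using hmom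
  have hprod : ∀ (ρ : ℝ) (ζ : Circle),
      ∏ j, ∑ t : ZMod K, (mixedKernel K L ρ ζ (z j * (ZMod.toCircle t)⁻¹) : ℂ) *
        (ZMod.toCircle t : ℂ) ^ α j =
      ∏ j ∈ α.support,
        (ρ * (a j + (ζ : ℂ) * ((z j : ℂ) ^ α j / (4 * L)) + (ζ : ℂ)⁻¹ * c j)) := by
    intro ρ ζ
    rw [← Finset.prod_subset (Finset.subset_univ α.support)]
    · exact Finset.prod_congr rfl fun j hj => hac j hj ρ ζ
    -- Variables outside the support contribute the total mass `1`, which removes any dependence on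
    -- `n`.
    · intro j _ hj
      rw [Finsupp.notMem_support_iff.1 hj]
      simp only [pow_zero, mul_one]
      rw [← Complex.ofReal_sum, sum_mixedKernel, Complex.ofReal_one]
  simp_rw [hprod]
  rw [sum_extrapolationWeight_mul_prod hd hN (4 * L) α.support hcard a
    (fun j => (z j : ℂ) ^ α j / (4 * L)) c,
    ← Finset.prod_subset (Finset.subset_univ α.support)]
  · refine Finset.prod_congr rfl fun j _ => ?_
    have : (L : ℂ) ≠ 0 := by exact_mod_cast hL0.ne'
    push_cast
    field_simp
  · intro j _ hj
    rw [Finsupp.notMem_support_iff.1 hj, pow_zero]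

/-! ### The dimension-free inequality -/

theorem theorem2p3 :
    ∃ C₁ C₂ : ℝ, 0 < C₁ ∧ 0 < C₂ ∧
      ∀ (d n K : ℕ), 1 ≤ d → 1 ≤ n → 2 ≤ K →
      ∀ (p : ℝ≥0∞), 1 ≤ p →
      ∀ (f : MvPolynomial (Fin n) ℂ), f.totalDegree ≤ d → (∀ j, f.degreeOf j ≤ K - 1) →
        eLpNorm (polyOnTorus f) p (torusMeasure n) ≤
          ENNReal.ofReal ((d : ℝ) * (C₁ * Real.log (K : ℝ) + C₂) ^ d) *
            eLpNorm (polyOnTorus f) p (cyclicMeasure K n) := by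
  -- The constants come from expanding `2e(4L + 1)` with `L = 3 + log K`.
  refine ⟨8 * Real.exp 1, 26 * Real.exp 1, by positivity, by positivity, ?_⟩
  intro d n K hd _ hK p hp f hf hfK
  have : NeZero K := ⟨by omega⟩
  have hlog : 0 ≤ Real.log K := Real.log_natCast_nonneg K
  set L : ℝ := 3 + Real.log K with hLdef
  have hL0 : 0 < L := by positivity
  have hL : ∀ z, ∑ t : ZMod K, ‖dirichletMean K (z * (ZMod.toCircle t)⁻¹)‖ ≤ L :=
    sum_norm_dirichletMean_le hK
  have hd0 : (0 : ℝ) < d := by exact_mod_cast hd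
  set G : ℕ → ZMod (2 * d + 1) → (Fin n → Circle) → ℂ := fun i t =>
    gridConvolution K (mixedKernel K L ((i : ℝ) / d) (ZMod.toCircle t)⁻¹) (polyOnTorus f)
  have hG : ∀ i t, Continuous (G i t) := fun i t =>
    continuous_gridConvolution (continuous_mixedKernel _) _
  have hGle : ∀ t, ∀ i ∈ Finset.range (d + 1), eLpNorm (G i t) p (torusMeasure n) ≤
      eLpNorm (polyOnTorus f) p (cyclicMeasure K n) := fun t i hi => by
    refine eLpNorm_gridConvolution_le (continuous_mixedKernel _)
      (mixedKernel_nonneg hL0 hL (by positivity) ?_ _) (sum_mixedKernel _) hp _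
    rw [div_le_one hd0]
    exact_mod_cast Nat.lt_succ_iff.1 (Finset.mem_range.1 hi)
  have hrep := polyOnTorus_eq_sum_gridConvolution (N := 2 * d + 1) (K := K) hd (by omega) hL0 f hf
    fun j => (hfK j).trans_lt (by omega)
  calc eLpNorm (polyOnTorus f) p (torusMeasure n)
      = eLpNorm (∑ t, ∑ i ∈ Finset.range (d + 1),
          extrapolationWeight d (2 * d + 1) (4 * L) i t • G i t) p (torusMeasure n) := by
        rw [← hrep]
    _ ≤ ∑ t, ∑ i ∈ Finset.range (d + 1), eLpNorm
          (extrapolationWeight d (2 * d + 1) (4 * L) i t • G i t) p (torusMeasure n) := by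
        have hmeas : ∀ t i, AEStronglyMeasurable
            (extrapolationWeight d (2 * d + 1) (4 * L) i t • G i t) (torusMeasure n) := fun t i =>
          ((hG i t).const_smul _).aestronglyMeasurable
        refine (eLpNorm_sum_le (fun t _ => Finset.aestronglyMeasurable_sum _
          fun i _ => hmeas t i) hp).trans (Finset.sum_le_sum fun t _ => ?_)
        exact eLpNorm_sum_le (fun i _ => hmeas t i) hp
    _ ≤ ∑ t, ∑ i ∈ Finset.range (d + 1),
          ENNReal.ofReal ‖extrapolationWeight d (2 * d + 1) (4 * L) i t‖ *
            eLpNorm (polyOnTorus f) p (cyclicMeasure K n) := by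
        refine Finset.sum_le_sum fun t _ => Finset.sum_le_sum fun i hi => ?_
        rw [eLpNorm_const_smul, ofReal_norm]
        gcongr
        exact hGle t i hi
    _ = ENNReal.ofReal (∑ t, ∑ i ∈ Finset.range (d + 1),
          ‖extrapolationWeight d (2 * d + 1) (4 * L) i t‖) *
            eLpNorm (polyOnTorus f) p (cyclicMeasure K n) := by
        simp_rw [← Finset.sum_mul]
        rw [ENNReal.ofReal_sum_of_nonneg fun t _ => Finset.sum_nonneg fun i _ => norm_nonneg _]
        simp_rw [ENNReal.ofReal_sum_of_nonneg fun i _ => norm_nonneg _]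
    _ ≤ _ := by
        gcongr
        refine (sum_norm_extrapolationWeight_le hd (by positivity)).trans ?_
        have he : 2 * Real.exp 1 * (4 * L + 1) =
            8 * Real.exp 1 * Real.log K + 26 * Real.exp 1 := by
          rw [hLdef]; ring
        rw [he]
        -- The bound already holds without the factor `d`, which is inserted using `d ≥ 1`.
        exact le_mul_of_one_le_left (by positivity) (by exact_mod_cast hd)
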